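/- Let $M$ be a smooth manifold, $g$ a semi-Riemannian metric on $M$ with Levi-Civita connection $\overline\nabla$, and $\sigma$ an almost paraquaternionic structure on $M$, that is, a rank-3 subbundle of $\mathrm{End}(TM)$ which near every point has a smooth local basis $J_1,J_2,J_3$ (a canonical local basis) with $$J_\alpha^2=-\epsilon_\alpha \mathrm{Id},\qquad J_\alpha J_{\alpha+1}=-J_{\alpha+1}J_\alpha=\epsilon_{\alpha+2}J_{\alpha+2},$$ where $\epsilon_1=1$, $\epsilon_2=\epsilon_3=-1$ and indices are taken modulo $3$. Suppose that $(M,\sigma,g)$ is a paraquaternionic Kähler manifold, i.e. $g(J_\alpha X,J_\alpha Y)=\epsilon_\alpha g(X,Y)$ for every canonical local basis, and $\sigma$ is parallel with respect to $\overline\nabla$. Let $N$ be an immersed submanifold of $M$ on which the induced metric is non-degenerate, let $B$ be its second fundamental form, i.e. $B(X,Y)$ is the component of $\overline\nabla_XY$ normal to $N$, and suppose that $N$ is a paraquaternionic CR-submanifold of $M$ with paraquaternionic distribution $\mathcal D$: $\mathcal D\subseteq TN$ is a smooth distribution on which $g$ is non-degenerate, and for every canonical local basis $J_1,J_2,J_3$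 of $\sigma$ on an open set $U\subseteq M$, every $x\in N\cap U$ and every $\alpha\in\{1,2,3\}$, $$J_\alpha\mathcal D_x=\mathcal D_x\qquad\text{and}\qquad J_\alpha\mathcal D_x^\perp\subseteq T_x^\perp N,$$ where $\mathcal D^\perp$ is the orthogonal complement of $\mathcal D$ in $TN$ and $T_x^\perp N$ is the normal space of $N$ at $x$. Then $\mathcal D$ is integrable (i.e. $[X,Y]\in\Gamma(\mathcal D)$ for all $X,Y\in\Gamma(\mathcal D)$) if and only if $N$ is $\mathcal D$-geodesic, i.e. $B(X,Y)=0$ for all $X,Y\in\Gamma(\mathcal D)$. -/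

import Mathlib

open scoped Manifold ContDiff
open Bundle

noncomputable section

namespace ParaquaternionicGeometry

section Ambient

variable {E : Type*} [NormedAddCommGroup E] [NormedSpace ℝ E]
  {M : Type*} [TopologicalSpace M] [ChartedSpace E M] [IsManifold 𝓘(ℝ, E) ∞ M]

/-- The (not necessarily continuous) vector field `X` is smooth on the set `U`. -/
def IsSmoothFieldOn (X : ∀ x : M, TangentSpace 𝓘(ℝ, E) x) (U : Set M) : Prop :=
  ContMDiffOn 𝓘(ℝ, E) 𝓘(ℝ, E).tangent ∞ (fun x ↦ (⟨x, X x⟩ : TangentBundle 𝓘(ℝ, E) M)) U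

/-- The field of endomorphisms `A` of the tangent spaces is smooth on the set `U`. -/
def IsSmoothEndOn (A : ∀ x : M, TangentSpace 𝓘(ℝ, E) x →L[ℝ] TangentSpace 𝓘(ℝ, E) x)
    (U : Set M) : Prop :=
  ContMDiffOn 𝓘(ℝ, E) (𝓘(ℝ, E).prod 𝓘(ℝ, E →L[ℝ] E)) ∞
    (fun x ↦ TotalSpace.mk' (E →L[ℝ] E)
      (E := fun x : M ↦ TangentSpace 𝓘(ℝ, E) x →L[ℝ] TangentSpace 𝓘(ℝ, E) x) x (A x)) U

variable (E M) in
/-- A semi-Riemannian metric: a smooth field of symmetric non-degenerate bilinear forms on the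
tangent spaces. -/
structure SemiRiemannianMetric where
  /-- the bilinear form `g_x` -/
  val (x : M) : TangentSpace 𝓘(ℝ, E) x →L[ℝ] TangentSpace 𝓘(ℝ, E) x →L[ℝ] ℝ
  symm (x : M) (v w : TangentSpace 𝓘(ℝ, E) x) : val x v w = val x w v
  nondegenerate (x : M) (v : TangentSpace 𝓘(ℝ, E) x) : (∀ w, val x v w = 0) → v = 0
  contMDiff :
    ContMDiff 𝓘(ℝ, E) (𝓘(ℝ, E).prod 𝓘(ℝ, E →L[ℝ] E →L[ℝ] ℝ)) ∞
      (fun x ↦ TotalSpace.mk' (E →L[ℝ] E →L[ℝ] ℝ)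
        (E := fun x : M ↦ TangentSpace 𝓘(ℝ, E) x →L[ℝ] TangentSpace 𝓘(ℝ, E) x →L[ℝ] ℝ)
        x (val x))

/-! ### The Levi-Civita connection

All formulas at a point `x` are written in the trivialization of `TM` given by the preferred chart
at `x`; over `x` itself this trivialization is the identity of `TangentSpace 𝓘(ℝ, E) x = E`. -/

/-- The metric near `x`, as a function into the bilinear forms on `E`, read in the chart
at `x`. -/
def SemiRiemannianMetric.inChart (g : SemiRiemannianMetric E M) (x y : M) : E →L[ℝ] E →L[ℝ] ℝ :=
  let S : E →L[ℝ] TangentSpace 𝓘(ℝ, E) y :=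
    (trivializationAt E (TangentSpace 𝓘(ℝ, E)) x).symmL ℝ y
  ContinuousLinearMap.precomp ℝ S ∘L g.val y ∘L S

/-- The Christoffel symbols `Γ(v, ·)` at `x` of the Levi-Civita connection, in the chart at `x`:
`2 g(Γ(v, w), z) = (∂_v g)(w, z) + (∂_w g)(v, z) - (∂_z g)(v, w)`. -/
def SemiRiemannianMetric.christoffel (g : SemiRiemannianMetric E M) (x : M)
    (v : TangentSpace 𝓘(ℝ, E) x) : TangentSpace 𝓘(ℝ, E) x →L[ℝ] TangentSpace 𝓘(ℝ, E) x :=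
  let dG : E →L[ℝ] E →L[ℝ] E →L[ℝ] ℝ :=
    mfderiv 𝓘(ℝ, E) 𝓘(ℝ, E →L[ℝ] E →L[ℝ] ℝ) (g.inChart x) x
  let lower : E →L[ℝ] E →L[ℝ] ℝ := (1 / 2 : ℝ) • (dG v + dG.flip v - (dG.flip v).flip)
  (g.val x).inverse ∘L lower

/-- The covariant derivative `(∇_v A)(x)`, for the connection on `End(TM)` induced by the
Levi-Civita connection, of a field `A` of endomorphisms: in the chart at `x` it is
`∂_v A + Γ(v, A ·) - A Γ(v, ·)`, so that `(∇_v A) Y = ∇_v (A Y) - A (∇_v Y)`. -/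
def SemiRiemannianMetric.covDerivEnd (g : SemiRiemannianMetric E M)
    (A : ∀ x : M, TangentSpace 𝓘(ℝ, E) x →L[ℝ] TangentSpace 𝓘(ℝ, E) x) (x : M)
    (v : TangentSpace 𝓘(ℝ, E) x) : TangentSpace 𝓘(ℝ, E) x →L[ℝ] TangentSpace 𝓘(ℝ, E) x :=
  let dA : TangentSpace 𝓘(ℝ, E) x →L[ℝ] TangentSpace 𝓘(ℝ, E) x →L[ℝ] TangentSpace 𝓘(ℝ, E) x :=
    mfderiv 𝓘(ℝ, E) 𝓘(ℝ, E →L[ℝ] E)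
      (fun y ↦ ContinuousLinearMap.inCoordinates E (TangentSpace 𝓘(ℝ, E)) E
        (TangentSpace 𝓘(ℝ, E)) x y x y (A y)) x
  dA v + g.christoffel x v ∘L A x - A x ∘L g.christoffel x v

/-! ### Almost paraquaternionic structures -/

/-- The signs `ε₁ = 1`, `ε₂ = ε₃ = -1`; the indices `1, 2, 3` modulo `3` are `0, 1, 2 : Fin 3`. -/
def epsilon : Fin 3 → ℝ := ![1, -1, -1]

/-- `J₁, J₂, J₃` is a canonical local basis over the open set `U` of the family `σ` of subspaces
of the spaces `End(T_x M)`. -/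
structure IsCanonicalLocalBasis
    (σ : ∀ x : M, Submodule ℝ (TangentSpace 𝓘(ℝ, E) x →L[ℝ] TangentSpace 𝓘(ℝ, E) x))
    (U : Set M)
    (J : Fin 3 → ∀ x : M, TangentSpace 𝓘(ℝ, E) x →L[ℝ] TangentSpace 𝓘(ℝ, E) x) : Prop where
  isOpen : IsOpen U
  smooth : ∀ a, IsSmoothEndOn (J a) U
  linearIndependent : ∀ x ∈ U, LinearIndependent ℝ (fun a ↦ J a x)
  span_eq : ∀ x ∈ U, Submodule.span ℝ (Set.range fun a ↦ J a x) = σ x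
  sq : ∀ x ∈ U, ∀ a, J a x ∘L J a x = -epsilon a • ContinuousLinearMap.id ℝ _
  mul : ∀ x ∈ U, ∀ a, J a x ∘L J (a + 1) x = epsilon (a + 2) • J (a + 2) x
  anticomm : ∀ x ∈ U, ∀ a, J a x ∘L J (a + 1) x = -(J (a + 1) x ∘L J a x)

variable (E M) in
/-- An almost paraquaternionic structure: a rank-3 subbundle `σ` of `End(TM)` which has a canonical
local basis near every point. -/
structure AlmostParaquaternionicStructure where
  /-- the fibre `σ_x` -/
  fiber (x : M) : Submodule ℝ (TangentSpace 𝓘(ℝ, E) x →L[ℝ] TangentSpace 𝓘(ℝ, E) x)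
  exists_basis (x : M) : ∃ U, x ∈ U ∧ ∃ J, IsCanonicalLocalBasis fiber U J

/-- The metric `g` is adapted to `σ`, i.e. `(M, σ, g)` is almost paraquaternionic hermitian. -/
def IsAdapted (g : SemiRiemannianMetric E M) (σ : AlmostParaquaternionicStructure E M) : Prop :=
  ∀ U J, IsCanonicalLocalBasis σ.fiber U J → ∀ x ∈ U, ∀ a v w,
    g.val x (J a x v) (J a x w) = epsilon a * g.val x v w

/-- The subbundle `σ` is parallel for the Levi-Civita connection of `g`: covariant derivatives of
smooth local sections of `σ` lie in `σ`. -/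
def IsParallel (g : SemiRiemannianMetric E M) (σ : AlmostParaquaternionicStructure E M) : Prop :=
  ∀ (U : Set M) (A : ∀ x : M, TangentSpace 𝓘(ℝ, E) x →L[ℝ] TangentSpace 𝓘(ℝ, E) x),
    IsOpen U → IsSmoothEndOn A U → (∀ x ∈ U, A x ∈ σ.fiber x) →
      ∀ x ∈ U, ∀ v, g.covDerivEnd A x v ∈ σ.fiber x

/-- `(M, σ, g)` is a paraquaternionic Kähler manifold. -/
structure IsParaquaternionicKahler (g : SemiRiemannianMetric E M)
    (σ : AlmostParaquaternionicStructure E M) : Prop where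
  adapted : IsAdapted g σ
  parallel : IsParallel g σ

end Ambient

/-! ### Distributions -/

section Distribution

variable {F : Type*} [NormedAddCommGroup F] [NormedSpace ℝ F]
  {N : Type*} [TopologicalSpace N] [ChartedSpace F N] [IsManifold 𝓘(ℝ, F) ∞ N]

/-- `D` is a smooth distribution, i.e. a smooth subbundle of `TN`: near every point it is spanned
by pointwise linearly independent smooth vector fields. -/
def IsSmoothDistribution (D : ∀ x : N, Submodule ℝ (TangentSpace 𝓘(ℝ, F) x)) : Prop :=
  ∀ x : N, ∃ U : Set N, IsOpen U ∧ x ∈ U ∧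
    ∃ (k : ℕ) (X : Fin k → ∀ y : N, TangentSpace 𝓘(ℝ, F) y),
      (∀ i, IsSmoothFieldOn (X i) U) ∧
      ∀ y ∈ U, LinearIndependent ℝ (fun i ↦ X i y) ∧
        Submodule.span ℝ (Set.range fun i ↦ X i y) = D y

/-- `X` is a smooth section of `D` over `U`. -/
def IsSectionOn (D : ∀ x : N, Submodule ℝ (TangentSpace 𝓘(ℝ, F) x))
    (X : ∀ x : N, TangentSpace 𝓘(ℝ, F) x) (U : Set N) : Prop :=
  IsSmoothFieldOn X U ∧ ∀ x ∈ U, X x ∈ D x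

/-- The distribution `D` is integrable: `[X, Y]` is a section of `D` whenever `X` and `Y` are
(over any open set). -/
def IsIntegrable (D : ∀ x : N, Submodule ℝ (TangentSpace 𝓘(ℝ, F) x)) : Prop :=
  ∀ (U : Set N) (X Y : ∀ x : N, TangentSpace 𝓘(ℝ, F) x), IsOpen U →
    IsSectionOn D X U → IsSectionOn D Y U →
      ∀ x ∈ U, VectorField.mlieBracket 𝓘(ℝ, F) X Y x ∈ D x

end Distribution

/-! ### Submanifolds -/

section Submanifold

variable {E : Type*} [NormedAddCommGroup E] [NormedSpace ℝ E]
  {M : Type*} [TopologicalSpace M] [ChartedSpace E M] [IsManifold 𝓘(ℝ, E) ∞ M]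
  {F : Type*} [NormedAddCommGroup F] [NormedSpace ℝ F]
  {N : Type*} [TopologicalSpace N] [ChartedSpace F N] [IsManifold 𝓘(ℝ, F) ∞ N]

/-- The covariant derivative at `p` in the direction `u ∈ T_p N`, for the Levi-Civita connection
of `g`, of a vector field `V` along the map `f : N → M`. In the chart at `f p` it is
`∂_u V + Γ(df u, V)`. -/
def SemiRiemannianMetric.covDerivAlong (g : SemiRiemannianMetric E M) (f : N → M)
    (V : ∀ q : N, TangentSpace 𝓘(ℝ, E) (f q)) (p : N) (u : TangentSpace 𝓘(ℝ, F) p) :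
    TangentSpace 𝓘(ℝ, E) (f p) :=
  let dV : TangentSpace 𝓘(ℝ, F) p →L[ℝ] TangentSpace 𝓘(ℝ, E) (f p) :=
    mfderiv 𝓘(ℝ, F) 𝓘(ℝ, E)
      (fun q ↦ (trivializationAt E (TangentSpace 𝓘(ℝ, E)) (f p) ⟨f q, V q⟩).2) p
  dV u + g.christoffel (f p) (mfderiv 𝓘(ℝ, F) 𝓘(ℝ, E) f p u) (V p)

/-- The bilinear form induced by `g` on `T_p N`. -/
def SemiRiemannianMetric.induced (g : SemiRiemannianMetric E M) (f : N → M) (p : N) :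
    TangentSpace 𝓘(ℝ, F) p →L[ℝ] TangentSpace 𝓘(ℝ, F) p →L[ℝ] ℝ :=
  ContinuousLinearMap.precomp ℝ (mfderiv 𝓘(ℝ, F) 𝓘(ℝ, E) f p) ∘L
    g.val (f p) ∘L mfderiv 𝓘(ℝ, F) 𝓘(ℝ, E) f p

variable (F) in
/-- `f : N → M` is an immersed submanifold which is non-degenerate for `g`. -/
structure IsNondegenerateSubmanifold (g : SemiRiemannianMetric E M) (f : N → M) : Prop where
  isImmersion : Manifold.IsImmersion 𝓘(ℝ, F) 𝓘(ℝ, E) ∞ f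
  nondegenerate (p : N) (u : TangentSpace 𝓘(ℝ, F) p) :
    (∀ v, g.induced (F := F) f p u v = 0) → u = 0

/-- The tangent part of `w ∈ T_{f p} M`, as an element of `T_p N`: the vector `u` with
`g(df u, df v) = g(w, df v)` for all `v`. -/
def SemiRiemannianMetric.tangentPart (g : SemiRiemannianMetric E M) (f : N → M) (p : N)
    (w : TangentSpace 𝓘(ℝ, E) (f p)) : TangentSpace 𝓘(ℝ, F) p :=
  (g.induced (F := F) f p).inverse (g.val (f p) w ∘L mfderiv 𝓘(ℝ, F) 𝓘(ℝ, E) f p)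

variable (F) in
/-- The normal part of `w ∈ T_{f p} M` in `T_{f p} M = T_p N ⊕ (T_p N)^⊥`. -/
def SemiRiemannianMetric.normalPart (g : SemiRiemannianMetric E M) (f : N → M) (p : N)
    (w : TangentSpace 𝓘(ℝ, E) (f p)) : TangentSpace 𝓘(ℝ, E) (f p) :=
  w - mfderiv 𝓘(ℝ, F) 𝓘(ℝ, E) f p (g.tangentPart (F := F) f p w)

/-- The second fundamental form `B(X, Y)` of the submanifold `f : N → M`: the normal part of the
ambient covariant derivative of `Y` along `X`. -/
def SemiRiemannianMetric.secondFundamentalForm (g : SemiRiemannianMetric E M) (f : N → M)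
    (X Y : ∀ q : N, TangentSpace 𝓘(ℝ, F) q) (p : N) : TangentSpace 𝓘(ℝ, E) (f p) :=
  g.normalPart F f p
    (g.covDerivAlong f (fun q ↦ mfderiv 𝓘(ℝ, F) 𝓘(ℝ, E) f q (Y q)) p (X p))

/-- `N` is `D`-geodesic: `B(X, Y) = 0` for all sections `X`, `Y` of `D` (over any open set). -/
def IsGeodesicFor (g : SemiRiemannianMetric E M) (f : N → M)
    (D : ∀ x : N, Submodule ℝ (TangentSpace 𝓘(ℝ, F) x)) : Prop :=
  ∀ (U : Set N) (X Y : ∀ x : N, TangentSpace 𝓘(ℝ, F) x), IsOpen U →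
    IsSectionOn D X U → IsSectionOn D Y U →
      ∀ x ∈ U, g.secondFundamentalForm f X Y x = 0

/-- The submanifold `f : N → M` of the almost paraquaternionic hermitian manifold `(M, σ, g)` is a
paraquaternionic CR-submanifold, with paraquaternionic distribution `D`. -/
structure IsParaquaternionicCRSubmanifold (g : SemiRiemannianMetric E M)
    (σ : AlmostParaquaternionicStructure E M) (f : N → M)
    (D : ∀ x : N, Submodule ℝ (TangentSpace 𝓘(ℝ, F) x)) : Prop where
  submanifold : IsNondegenerateSubmanifold F g f
  smooth : IsSmoothDistribution D
  nondegenerate : ∀ x, ∀ u ∈ D x, (∀ v ∈ D x, g.induced f x u v = 0) → u = 0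
  /-- `J_α D_x = D_x` -/
  invariant : ∀ U J, IsCanonicalLocalBasis σ.fiber U J → ∀ x, f x ∈ U → ∀ a : Fin 3,
    ((D x).map (mfderiv 𝓘(ℝ, F) 𝓘(ℝ, E) f x).toLinearMap).map (J a (f x)).toLinearMap =
      (D x).map (mfderiv 𝓘(ℝ, F) 𝓘(ℝ, E) f x).toLinearMap
  /-- `J_α` maps the orthogonal complement of `D_x` in `T_x N` into the normal space -/
  totallyReal : ∀ U J, IsCanonicalLocalBasis σ.fiber U J → ∀ x, f x ∈ U → ∀ a : Fin 3,
    ∀ u : TangentSpace 𝓘(ℝ, F) x, (∀ v ∈ D x, g.induced f x u v = 0) →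
      ∀ v : TangentSpace 𝓘(ℝ, F) x,
        g.val (f x) (J a (f x) (mfderiv 𝓘(ℝ, F) 𝓘(ℝ, E) f x u))
          (mfderiv 𝓘(ℝ, F) 𝓘(ℝ, E) f x v) = 0

end Submanifold

end ParaquaternionicGeometry

end

/-! Write ∇ for the ambient connection along `f`, and number the structures J₀, J₁, J₂ as in `Fin
3`. Two facts drive both directions. First, ∇ is torsion-free (`covDerivAlong_sub_covDerivAlong`),
so ∇_X Y - ∇_Y X is the image of [X, Y] and B is symmetric on sections of D. Second, σ is parallel,
so (∇J_a)Y is a combination of the J_b Y, which lie in D when Y does; hence ∇_X(J_a Y) equals J_a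
∇_X Y up to an element of D (`exists_covDerivAlong_eq`).

Suppose D is integrable. Then B(X, J_a Y) - B(J_a X, Y) is the normal part of J_a[X, Y], which is
zero because [X, Y] lies in D and J_a preserves D. So each J_a passes from one slot of B to the
other. Moving J₀J₁ across reverses the order of the factors, and J₁J₀ = -J₀J₁ = J₂, so J₂ also
passes across with a minus sign. Hence B(J₂X, Y) = 0, and J₂ is invertible.

Conversely, suppose B vanishes on D and let Z in TN be orthogonal to D. Then ∇_X(J₀Y) is tangent to
N, hence so is J₀∇_X Y, whereas J₀Z is normal. As J₀ is an isometry, g(∇_X Y, Z) = g(J₀∇_X Y, J₀Z) =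
0. Antisymmetrizing, [X, Y] is orthogonal to the complement of D, so it lies in D.

The rest is calculus in the preferred charts, plus the smoothness of J_a X as a vector field on N.
-/

noncomputable section

namespace ParaquaternionicGeometry

/-! ### Lie brackets as commutators of derivations, read in a chart. -/

section LieBracket

variable {F : Type*} [NormedAddCommGroup F] [NormedSpace ℝ F]
  {N : Type*} [TopologicalSpace N] [ChartedSpace F N]

/-- The vector field `Z`, read in the preferred chart at `p`. -/
def fieldInChart (p : N) (Z : ∀ q : N, TangentSpace 𝓘(ℝ, F) q) : F → F :=
  VectorField.mpullbackWithin 𝓘(ℝ, F) 𝓘(ℝ, F) (extChartAt 𝓘(ℝ, F) p).symm Z (Set.range 𝓘(ℝ, F))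

variable [IsManifold 𝓘(ℝ, F) ∞ N] {E : Type*} [NormedAddCommGroup E] [NormedSpace ℝ E]

lemma isManifold_two : IsManifold 𝓘(ℝ, F) 2 N :=
  IsManifold.of_le (n := ∞) (by norm_cast)

lemma isManifold_one : IsManifold 𝓘(ℝ, F) 1 N :=
  IsManifold.of_le (n := ∞) (by norm_cast)

lemma mfderiv_chart_symm_fieldInChart {p : N} {y : F} (hy : y ∈ (extChartAt 𝓘(ℝ, F) p).target)
    (Z : ∀ q : N, TangentSpace 𝓘(ℝ, F) q) :
    mfderiv 𝓘(ℝ, F) 𝓘(ℝ, F) (extChartAt 𝓘(ℝ, F) p).symm y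
        (fieldInChart (F := F) p Z y) =
      Z ((extChartAt 𝓘(ℝ, F) p).symm y) := by
  have := isManifold_one (F := F) (N := N)
  have hinv := isInvertible_mfderivWithin_extChartAt_symm (I := 𝓘(ℝ, F)) (x := p) hy
  unfold fieldInChart
  rw [VectorField.mpullbackWithin_apply]
  have hr : Set.range 𝓘(ℝ, F) = Set.univ := by simp
  rw [hr] at hinv ⊢
  rw [← mfderivWithin_univ]
  exact hinv.self_apply_inverse _

lemma fieldInChart_self (p : N) (Z : ∀ q : N, TangentSpace 𝓘(ℝ, F) q) :
    fieldInChart p Z (extChartAt 𝓘(ℝ, F) p p) = Z p := by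
  have := isManifold_one (F := F) (N := N)
  have h := mfderivWithin_extChartAt_symm_inverse_apply (I := 𝓘(ℝ, F)) (x := p)
    (Z ((extChartAt 𝓘(ℝ, F) p).symm (extChartAt 𝓘(ℝ, F) p p)))
  refine h.trans ?_
  rw [extChartAt_to_inv]

lemma differentiableAt_fieldInChart [CompleteSpace F] {p : N}
    {Z : ∀ q : N, TangentSpace 𝓘(ℝ, F) q}
    (hZ : MDifferentiableAt 𝓘(ℝ, F) 𝓘(ℝ, F).tangent
      (fun x ↦ (⟨x, Z x⟩ : TangentBundle 𝓘(ℝ, F) N)) p) :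
    DifferentiableAt ℝ (fieldInChart p Z) (extChartAt 𝓘(ℝ, F) p p) := by
  have := isManifold_two (F := F) (N := N)
  have h : DifferentiableWithinAt ℝ (fieldInChart p Z) _ _ :=
    (mdifferentiableWithinAt_univ.2 hZ).differentiableWithinAt_mpullbackWithin_vectorField
  rwa [Set.preimage_univ, Set.univ_inter, modelWithCornersSelf_coe, Set.range_id,
      differentiableWithinAt_univ] at h

/-- The derivative of a vector-valued function `h` along a vector field, read in a chart. -/
lemma fderiv_comp_chart_symm_fieldInChart {h : N → E} {p : N} {y : F}
    (hy : y ∈ (extChartAt 𝓘(ℝ, F) p).target)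
    (hh : MDifferentiableAt 𝓘(ℝ, F) 𝓘(ℝ, E) h ((extChartAt 𝓘(ℝ, F) p).symm y))
    (Z : ∀ q : N, TangentSpace 𝓘(ℝ, F) q) :
    fderiv ℝ (h ∘ (extChartAt 𝓘(ℝ, F) p).symm) y (fieldInChart p Z y) =
      mvfderiv 𝓘(ℝ, F) h ((extChartAt 𝓘(ℝ, F) p).symm y)
        (Z ((extChartAt 𝓘(ℝ, F) p).symm y)) := by
  have := isManifold_one (F := F) (N := N)
  have hd := mdifferentiableWithinAt_extChartAt_symm (I := 𝓘(ℝ, F)) (x := p) hy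
  rw [modelWithCornersSelf_coe, Set.range_id, mdifferentiableWithinAt_univ] at hd
  rw [← mfderiv_chart_symm_fieldInChart hy Z, ← mfderiv_eq_fderiv, mfderiv_comp _ hh hd]
  rfl

/-- The preferred chart at `p` has the identity as its derivative at `p`, so no correction factor
appears. -/
lemma mvfderiv_eq_fderiv_comp_chart_symm {A : N → E} {p : N}
    (hA : DifferentiableAt ℝ (A ∘ (extChartAt 𝓘(ℝ, F) p).symm) (extChartAt 𝓘(ℝ, F) p p))
    (v : TangentSpace 𝓘(ℝ, F) p) :
    mvfderiv 𝓘(ℝ, F) A p v =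
      fderiv ℝ (A ∘ (extChartAt 𝓘(ℝ, F) p).symm) (extChartAt 𝓘(ℝ, F) p p) v := by
  have := isManifold_one (F := F) (N := N)
  have hφ : MDifferentiableAt 𝓘(ℝ, F) 𝓘(ℝ, F) (extChartAt 𝓘(ℝ, F) p) p :=
    mdifferentiableAt_extChartAt (mem_chart_source F p)
  have he : A =ᶠ[nhds p] (A ∘ (extChartAt 𝓘(ℝ, F) p).symm) ∘ extChartAt 𝓘(ℝ, F) p := by
    filter_upwards [extChartAt_source_mem_nhds (I := 𝓘(ℝ, F)) p] with q hq
    simp only [Function.comp_apply, (extChartAt 𝓘(ℝ, F) p).left_inv hq]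
  have h1 : mfderiv 𝓘(ℝ, F) 𝓘(ℝ, E) A p =
      (fderiv ℝ (A ∘ (extChartAt 𝓘(ℝ, F) p).symm) (extChartAt 𝓘(ℝ, F) p p)).comp
      (mfderiv 𝓘(ℝ, F) 𝓘(ℝ, F) (extChartAt 𝓘(ℝ, F) p) p) := by
    rw [he.mfderiv_eq, mfderiv_comp p hA.mdifferentiableAt hφ, mfderiv_eq_fderiv]
    rfl
  rw [mfderiv_extChartAt_self] at h1
  exact congrArg (fun L : F →L[ℝ] E ↦ L v) h1

/-- The bracket of vector fields acts on vector-valued functions as a commutator. -/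
lemma mvfderiv_mlieBracket [CompleteSpace F] {h : N → E} {p : N}
    {X Y : ∀ q : N, TangentSpace 𝓘(ℝ, F) q}
    (hh : ContMDiffAt 𝓘(ℝ, F) 𝓘(ℝ, E) ∞ h p)
    (hX : MDifferentiableAt 𝓘(ℝ, F) 𝓘(ℝ, F).tangent
      (fun x ↦ (⟨x, X x⟩ : TangentBundle 𝓘(ℝ, F) N)) p)
    (hY : MDifferentiableAt 𝓘(ℝ, F) 𝓘(ℝ, F).tangent
      (fun x ↦ (⟨x, Y x⟩ : TangentBundle 𝓘(ℝ, F) N)) p) :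
    mvfderiv 𝓘(ℝ, F) h p (VectorField.mlieBracket 𝓘(ℝ, F) X Y p) =
      mvfderiv 𝓘(ℝ, F) (fun q ↦ mvfderiv 𝓘(ℝ, F) h q (Y q)) p (X p) -
      mvfderiv 𝓘(ℝ, F) (fun q ↦ mvfderiv 𝓘(ℝ, F) h q (X q)) p (Y p) := by
  have := isManifold_one (F := F) (N := N)
  set φ := extChartAt 𝓘(ℝ, F) p with hφ
  have hc : ContDiffAt ℝ ∞ (h ∘ φ.symm) (φ p) := by
    have := (contMDiffAt_iff.1 hh).2
    rw [modelWithCornersSelf_coe, Set.range_id, contDiffWithinAt_univ] at this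
    exact this
  -- The inner derivative is taken at points near `p`, so differentiability of `h` at `p` alone
  -- would not do.
  have hev : ∀ᶠ y in nhds (φ p), y ∈ φ.target ∧
      MDifferentiableAt 𝓘(ℝ, F) 𝓘(ℝ, E) h (φ.symm y) := by
    refine Filter.Eventually.and (extChartAt_target_mem_nhds p) ?_
    have h1 : ∀ᶠ q in nhds p, MDifferentiableAt 𝓘(ℝ, F) 𝓘(ℝ, E) h q := by
      have h2 : ContMDiffAt 𝓘(ℝ, F) 𝓘(ℝ, E) 1 h p := hh.of_le (by norm_cast)
      exact ((contMDiffAt_iff_contMDiffAt_nhds (by simp)).1 h2).mono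
        fun q hq ↦ hq.mdifferentiableAt (by simp)
    have h3 := continuousAt_extChartAt_symm (I := 𝓘(ℝ, F)) p
    rw [ContinuousAt, extChartAt_to_inv] at h3
    exact h3.eventually h1
  have key (Z : ∀ q : N, TangentSpace 𝓘(ℝ, F) q) (v : TangentSpace 𝓘(ℝ, F) p)
      (hZ : DifferentiableAt ℝ (fieldInChart p Z) (φ p)) :
      mvfderiv 𝓘(ℝ, F) (fun q ↦ mvfderiv 𝓘(ℝ, F) h q (Z q)) p v =
        fderiv ℝ (fun y ↦ fderiv ℝ (h ∘ φ.symm) y (fieldInChart p Z y)) (φ p) v := by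
    have he : (fun q ↦ mvfderiv 𝓘(ℝ, F) h q (Z q)) ∘ φ.symm =ᶠ[nhds (φ p)]
        (fun y ↦ fderiv ℝ (h ∘ φ.symm) y (fieldInChart p Z y)) :=
      hev.mono fun y hy ↦ (fderiv_comp_chart_symm_fieldInChart hy.1 hy.2 Z).symm
    have hd : DifferentiableAt ℝ (fun y ↦ fderiv ℝ (h ∘ φ.symm) y (fieldInChart p Z y)) (φ p) :=
      ((hc.fderiv_right (m := 1) (by norm_cast)).differentiableAt (by simp)).clm_apply hZ
    rw [mvfderiv_eq_fderiv_comp_chart_symm (he.differentiableAt_iff.2 hd), he.fderiv_eq]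
  have hbr : VectorField.mlieBracket 𝓘(ℝ, F) X Y p =
      VectorField.lieBracket ℝ (fieldInChart p X) (fieldInChart p Y) (φ p) := by
    have h1 := VectorField.mlieBracketWithin_apply (I := 𝓘(ℝ, F)) (V := X) (W := Y) (s := Set.univ)
      (x₀ := p)
    rw [VectorField.mlieBracketWithin_univ, mfderiv_extChartAt_self] at h1
    refine h1.trans ((congrArg (fun L : F →L[ℝ] F ↦ L _) ContinuousLinearMap.inverse_id).trans ?_)
    rw [Set.preimage_univ, Set.univ_inter]
    change VectorField.lieBracketWithin ℝ (fieldInChart p X) (fieldInChart p Y) (Set.range id) _ = _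
    rw [Set.range_id, VectorField.lieBracketWithin_univ]
  have dX := differentiableAt_fieldInChart hX
  have dY := differentiableAt_fieldInChart hY
  rw [key X _ dX, key Y _ dY]
  refine (mvfderiv_eq_fderiv_comp_chart_symm (hc.differentiableAt (by simp)) _).trans ?_
  refine (congrArg (fun w : F ↦ fderiv ℝ (h ∘ φ.symm) (φ p) w) hbr).trans ?_
  -- Symmetry of the second derivative of `h` enters here.
  refine (VectorField.fderiv_apply_lieBracket hc (by simp; norm_cast) dY dX).trans ?_
  rw [fieldInChart_self, fieldInChart_self]

end LieBracket

/-! ### Symmetry of the Christoffel symbols; coordinates at the centre of a chart. -/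

section Ambient

variable {E : Type*} [NormedAddCommGroup E] [NormedSpace ℝ E]
  {M : Type*} [TopologicalSpace M] [ChartedSpace E M] [IsManifold 𝓘(ℝ, E) ∞ M]

lemma SemiRiemannianMetric.inChart_symm (g : SemiRiemannianMetric E M) (x y : M) (v w : E) :
    g.inChart x y v w = g.inChart x y w v :=
  g.symm y _ _

set_option synthInstance.maxHeartbeats 200000 in
lemma SemiRiemannianMetric.mfderiv_inChart_symm (g : SemiRiemannianMetric E M) (x : M)
    (z v w : E) :
    mvfderiv 𝓘(ℝ, E) (g.inChart x) x z v w = mvfderiv 𝓘(ℝ, E) (g.inChart x) x z w v := by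
  by_cases h : MDifferentiableAt 𝓘(ℝ, E) 𝓘(ℝ, E →L[ℝ] E →L[ℝ] ℝ) (g.inChart x) x
  -- Flipping arguments is linear and fixes the metric, so by the chain rule and uniqueness it fixes
  -- the derivative.
  · let Φ := (ContinuousLinearMap.flipₗᵢ ℝ E E ℝ).toContinuousLinearEquiv
    have h1 := (ContinuousLinearEquiv.hasMFDerivAt (E' := E →L[ℝ] E →L[ℝ] ℝ) Φ).comp x
      h.hasMFDerivAt
    have h2 : Φ ∘ g.inChart x = g.inChart x := by
      ext y a b
      exact g.inChart_symm x y b a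
    rw [h2] at h1
    have h3 := hasMFDerivAt_unique h.hasMFDerivAt h1
    exact congrArg (fun L : E →L[ℝ] E →L[ℝ] E →L[ℝ] ℝ ↦ L z v w) h3
  -- Otherwise the derivative has its default value 0.
  · have h0 := mfderiv_zero_of_not_mdifferentiableAt h
    have h1 : mvfderiv 𝓘(ℝ, E) (g.inChart x) x = 0 := by
      rw [mvfderiv, h0]; simp
    rw [h1]
    rfl

-- Exchanging `v` and `w` swaps the first two terms of the Koszul formula and fixes the third, since
-- each derivative of the metric is symmetric. The lowered symbols already agree, so nothing about
-- `inverse` is needed.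
set_option synthInstance.maxHeartbeats 200000 in
lemma SemiRiemannianMetric.christoffel_symm (g : SemiRiemannianMetric E M) (x : M)
    (v w : TangentSpace 𝓘(ℝ, E) x) : g.christoffel x v w = g.christoffel x w v := by
  let dG : E →L[ℝ] E →L[ℝ] E →L[ℝ] ℝ := mvfderiv 𝓘(ℝ, E) (g.inChart x) x
  have h (v w : E) : ((1 / 2 : ℝ) • (dG v + dG.flip v - (dG.flip v).flip)) w =
      ((1 / 2 : ℝ) • (dG w + dG.flip w - (dG.flip w).flip)) v := by
    ext z
    have := g.mfderiv_inChart_symm x z v w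
    change dG z v w = dG z w v at this
    simp [this]
    ring
  exact congrArg (fun L ↦ (g.val x).inverse L) (h v w)

lemma continuousLinearMapAt_trivializationAt_self (x : M) (v : TangentSpace 𝓘(ℝ, E) x) :
    (trivializationAt E (TangentSpace 𝓘(ℝ, E)) x).continuousLinearMapAt ℝ x v = v := by
  have := isManifold_one (F := E) (N := M)
  rw [TangentBundle.continuousLinearMapAt_trivializationAt (mem_chart_source E x),
    mfderiv_extChartAt_self]
  rfl

lemma trivializationAt_apply_snd {x y : M} (hy : y ∈ (chartAt E x).source)
    (v : TangentSpace 𝓘(ℝ, E) y) :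
    (trivializationAt E (TangentSpace 𝓘(ℝ, E)) x ⟨y, v⟩).2 =
      (trivializationAt E (TangentSpace 𝓘(ℝ, E)) x).continuousLinearMapAt ℝ y v := by
  rw [Trivialization.continuousLinearMapAt_apply,
    Trivialization.coe_linearMapAt_of_mem _ (by simpa using hy)]

lemma trivializationAt_self_snd (x : M) (v : TangentSpace 𝓘(ℝ, E) x) :
    (trivializationAt E (TangentSpace 𝓘(ℝ, E)) x ⟨x, v⟩).2 = v := by
  rw [trivializationAt_apply_snd (mem_chart_source E x),
    continuousLinearMapAt_trivializationAt_self]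

lemma inCoordinates_trivialization {x y : M} (hy : y ∈ (chartAt E x).source)
    (A : TangentSpace 𝓘(ℝ, E) y →L[ℝ] TangentSpace 𝓘(ℝ, E) y) (v : TangentSpace 𝓘(ℝ, E) y) :
    ContinuousLinearMap.inCoordinates E (TangentSpace 𝓘(ℝ, E)) E
        (TangentSpace 𝓘(ℝ, E)) x y x y A
        (trivializationAt E (TangentSpace 𝓘(ℝ, E)) x ⟨y, v⟩).2 =
      (trivializationAt E (TangentSpace 𝓘(ℝ, E)) x ⟨y, A v⟩).2 := by
  have hy' : y ∈ (trivializationAt E (TangentSpace 𝓘(ℝ, E)) x).baseSet := by simpa using hy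
  rw [trivializationAt_apply_snd hy, trivializationAt_apply_snd hy]
  exact congrArg
    (fun u ↦ (trivializationAt E (TangentSpace 𝓘(ℝ, E)) x).continuousLinearMapAt ℝ y (A u))
    ((trivializationAt E (TangentSpace 𝓘(ℝ, E)) x).symmL_continuousLinearMapAt hy' v)

lemma inCoordinates_self (x : M) (A : TangentSpace 𝓘(ℝ, E) x →L[ℝ] TangentSpace 𝓘(ℝ, E) x) :
    ContinuousLinearMap.inCoordinates E (TangentSpace 𝓘(ℝ, E)) E
        (TangentSpace 𝓘(ℝ, E)) x x x x A = A := by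
  ext v
  have h := inCoordinates_trivialization (mem_chart_source E x) A v
  have h1 := trivializationAt_self_snd x (v : TangentSpace 𝓘(ℝ, E) x)
  rw [trivializationAt_self_snd x (A v)] at h
  exact (congrArg _ h1.symm).trans h

end Ambient

/-! ### Torsion-freeness and the Leibniz rule along a map. -/

section Submanifold

variable {E : Type*} [NormedAddCommGroup E] [NormedSpace ℝ E]
  {M : Type*} [TopologicalSpace M] [ChartedSpace E M] [IsManifold 𝓘(ℝ, E) ∞ M]
  {F : Type*} [NormedAddCommGroup F] [NormedSpace ℝ F]
  {N : Type*} [TopologicalSpace N] [ChartedSpace F N] [IsManifold 𝓘(ℝ, F) ∞ N]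

/-- The vector field `V` along `f`, read in the preferred chart at `f p`. -/
def alongInChart (f : N → M) (V : ∀ q : N, TangentSpace 𝓘(ℝ, E) (f q)) (p q : N) : E :=
  (trivializationAt E (TangentSpace 𝓘(ℝ, E)) (f p) ⟨f q, V q⟩).2

-- The explicit `HAdd` performs the sum in `E`, to which the tangent spaces are only definitionally
-- equal.
omit [IsManifold 𝓘(ℝ, F) ∞ N] in
lemma SemiRiemannianMetric.covDerivAlong_eq (g : SemiRiemannianMetric E M) (f : N → M)
    (V : ∀ q : N, TangentSpace 𝓘(ℝ, E) (f q)) (p : N) (u : TangentSpace 𝓘(ℝ, F) p) :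
    g.covDerivAlong f V p u = HAdd.hAdd (α := E) (β := E)
      (mvfderiv 𝓘(ℝ, F) (alongInChart f V p) p u)
      (g.christoffel (f p) (mfderiv 𝓘(ℝ, F) 𝓘(ℝ, E) f p u) (V p)) :=
  rfl

-- This turns derivatives of pushed-forward fields into iterated derivatives of the chart expression
-- of `f`, to which `mvfderiv_mlieBracket` applies.
omit [IsManifold 𝓘(ℝ, F) ∞ N] in
lemma alongInChart_mfderiv {f : N → M} {p q : N} (hf : MDifferentiableAt 𝓘(ℝ, F) 𝓘(ℝ, E) f q)
    (hq : f q ∈ (chartAt E (f p)).source) (Y : ∀ q : N, TangentSpace 𝓘(ℝ, F) q) :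
    alongInChart f (fun q ↦ mfderiv 𝓘(ℝ, F) 𝓘(ℝ, E) f q (Y q)) p q =
      mvfderiv 𝓘(ℝ, F) (extChartAt 𝓘(ℝ, E) (f p) ∘ f) q (Y q) := by
  have := isManifold_one (F := E) (N := M)
  unfold alongInChart
  rw [trivializationAt_apply_snd hq, TangentBundle.continuousLinearMapAt_trivializationAt hq,
    mvfderiv, mfderiv_comp q (mdifferentiableAt_extChartAt hq) hf]
  rfl

omit [IsManifold 𝓘(ℝ, F) ∞ N] in
lemma mvfderiv_extChartAt_comp {f : N → M} {p : N} (hf : MDifferentiableAt 𝓘(ℝ, F) 𝓘(ℝ, E) f p)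
    (u : TangentSpace 𝓘(ℝ, F) p) :
    mvfderiv 𝓘(ℝ, F) (extChartAt 𝓘(ℝ, E) (f p) ∘ f) p u = mfderiv 𝓘(ℝ, F) 𝓘(ℝ, E) f p u := by
  have := isManifold_one (F := E) (N := M)
  rw [mvfderiv, mfderiv_comp p (mdifferentiableAt_extChartAt (mem_chart_source E (f p))) hf,
    mfderiv_extChartAt_self]
  rfl

/-- The Levi-Civita connection is torsion-free along smooth maps. -/
lemma SemiRiemannianMetric.covDerivAlong_sub_covDerivAlong [CompleteSpace F]
    (g : SemiRiemannianMetric E M) {f : N → M} (hf : ContMDiff 𝓘(ℝ, F) 𝓘(ℝ, E) ∞ f) {p : N}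
    {X Y : ∀ q : N, TangentSpace 𝓘(ℝ, F) q}
    (hX : MDifferentiableAt 𝓘(ℝ, F) 𝓘(ℝ, F).tangent
      (fun x ↦ (⟨x, X x⟩ : TangentBundle 𝓘(ℝ, F) N)) p)
    (hY : MDifferentiableAt 𝓘(ℝ, F) 𝓘(ℝ, F).tangent
      (fun x ↦ (⟨x, Y x⟩ : TangentBundle 𝓘(ℝ, F) N)) p) :
    g.covDerivAlong f (fun q ↦ mfderiv 𝓘(ℝ, F) 𝓘(ℝ, E) f q (Y q)) p (X p) -
      g.covDerivAlong f (fun q ↦ mfderiv 𝓘(ℝ, F) 𝓘(ℝ, E) f q (X q)) p (Y p) =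
      mfderiv 𝓘(ℝ, F) 𝓘(ℝ, E) f p (VectorField.mlieBracket 𝓘(ℝ, F) X Y p) := by
  have hfd (q : N) : MDifferentiableAt 𝓘(ℝ, F) 𝓘(ℝ, E) f q :=
    (hf q).mdifferentiableAt (by simp)
  have hev : ∀ᶠ q in nhds p, f q ∈ (chartAt E (f p)).source :=
    hf.continuous.continuousAt.eventually (chart_source_mem_nhds E (f p))
  have hloc (Z : ∀ q : N, TangentSpace 𝓘(ℝ, F) q) (u : TangentSpace 𝓘(ℝ, F) p) :
      mvfderiv 𝓘(ℝ, F)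
        (alongInChart f (fun q ↦ mfderiv 𝓘(ℝ, F) 𝓘(ℝ, E) f q (Z q)) p) p u =
      mvfderiv 𝓘(ℝ, F)
        (fun q ↦ mvfderiv 𝓘(ℝ, F) (extChartAt 𝓘(ℝ, E) (f p) ∘ f) q (Z q)) p u := by
    have h : alongInChart f (fun q ↦ mfderiv 𝓘(ℝ, F) 𝓘(ℝ, E) f q (Z q)) p =ᶠ[nhds p]
        (fun q ↦ mvfderiv 𝓘(ℝ, F) (extChartAt 𝓘(ℝ, E) (f p) ∘ f) q (Z q)) :=
      hev.mono fun q hq ↦ alongInChart_mfderiv (hfd q) hq Z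
    exact congrArg (fun L : F →L[ℝ] E ↦ L u) h.mfderiv_eq
  have hh : ContMDiffAt 𝓘(ℝ, F) 𝓘(ℝ, E) ∞ (extChartAt 𝓘(ℝ, E) (f p) ∘ f) p :=
    contMDiffAt_extChartAt.comp p (hf p)
  have hbr := mvfderiv_mlieBracket hh hX hY
  rw [mvfderiv_extChartAt_comp (hfd p), ← hloc Y (X p), ← hloc X (Y p)] at hbr
  rw [g.covDerivAlong_eq, g.covDerivAlong_eq,
    g.christoffel_symm (f p) _ (mfderiv 𝓘(ℝ, F) 𝓘(ℝ, E) f p (Y p))]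
  refine Eq.trans ?_ hbr.symm
  exact add_sub_add_right_eq_sub (G := E) _ _ _

omit [IsManifold 𝓘(ℝ, F) ∞ N] in
lemma differentiableAt_comp_chart_symm {G : Type*} [NormedAddCommGroup G] [NormedSpace ℝ G]
    {a : N → G} {p : N} (ha : MDifferentiableAt 𝓘(ℝ, F) 𝓘(ℝ, G) a p) :
    DifferentiableAt ℝ (a ∘ (extChartAt 𝓘(ℝ, F) p).symm) (extChartAt 𝓘(ℝ, F) p p) := by
  have h := (mdifferentiableAt_iff _ _).1 ha |>.2
  rw [modelWithCornersSelf_coe, Set.range_id, differentiableWithinAt_univ] at h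
  exact h

lemma mvfderiv_clm_apply {G H : Type*} [NormedAddCommGroup G] [NormedSpace ℝ G]
    [NormedAddCommGroup H] [NormedSpace ℝ H] {a : N → G →L[ℝ] H} {b : N → G} {p : N}
    (ha : MDifferentiableAt 𝓘(ℝ, F) 𝓘(ℝ, G →L[ℝ] H) a p)
    (hb : MDifferentiableAt 𝓘(ℝ, F) 𝓘(ℝ, G) b p) (u : TangentSpace 𝓘(ℝ, F) p) :
    mvfderiv 𝓘(ℝ, F) (fun q ↦ a q (b q)) p u =
      mvfderiv 𝓘(ℝ, F) a p u (b p) + a p (mvfderiv 𝓘(ℝ, F) b p u) := by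
  have ha' := differentiableAt_comp_chart_symm ha
  have hb' := differentiableAt_comp_chart_symm hb
  rw [mvfderiv_eq_fderiv_comp_chart_symm ha', mvfderiv_eq_fderiv_comp_chart_symm hb',
    mvfderiv_eq_fderiv_comp_chart_symm (A := fun q ↦ a q (b q)) (ha'.clm_apply hb')]
  have := fderiv_clm_apply ha' hb'
  refine (congrArg (fun L : F →L[ℝ] H ↦ L u) this).trans ?_
  simp only [Function.comp_apply, extChartAt_to_inv]
  exact add_comm _ _

/-- The Leibniz rule for a field of endomorphisms applied to a vector field along a map. -/
lemma SemiRiemannianMetric.covDerivAlong_end_apply (g : SemiRiemannianMetric E M) {f : N → M}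
    {p : N} (hf : MDifferentiableAt 𝓘(ℝ, F) 𝓘(ℝ, E) f p)
    {A : ∀ x : M, TangentSpace 𝓘(ℝ, E) x →L[ℝ] TangentSpace 𝓘(ℝ, E) x}
    {U : Set M} (hU : IsOpen U) (hA : IsSmoothEndOn A U) (hp : f p ∈ U)
    {V : ∀ q : N, TangentSpace 𝓘(ℝ, E) (f q)}
    (hV : MDifferentiableAt 𝓘(ℝ, F) 𝓘(ℝ, E) (alongInChart f V p) p) (u : TangentSpace 𝓘(ℝ, F) p) :
    g.covDerivAlong f (fun q ↦ A (f q) (V q)) p u =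
      g.covDerivEnd A (f p) (mfderiv 𝓘(ℝ, F) 𝓘(ℝ, E) f p u) (V p) +
        A (f p) (g.covDerivAlong f V p u) := by
  -- `K` is `A` in the chart at `f p`; the product rule for `K ∘ f` gives the non-Christoffel terms.
  let K (y : M) : E →L[ℝ] E := ContinuousLinearMap.inCoordinates E (TangentSpace 𝓘(ℝ, E)) E
        (TangentSpace 𝓘(ℝ, E)) (f p) y (f p) y (A y)
  have hK : MDifferentiableAt 𝓘(ℝ, E) 𝓘(ℝ, E →L[ℝ] E) K (f p) := by
    have h1 := hA.contMDiffAt (hU.mem_nhds hp)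
    have h2 := ((contMDiffAt_hom_bundle _).1 h1).2
    exact h2.mdifferentiableAt (by simp)
  have hev : ∀ᶠ q in nhds p, f q ∈ (chartAt E (f p)).source :=
    hf.continuousAt.eventually (chart_source_mem_nhds E (f p))
  have h1 : alongInChart f (fun q ↦ A (f q) (V q)) p =ᶠ[nhds p]
      fun q ↦ K (f q) (alongInChart f V p q) :=
    hev.mono fun q hq ↦ (inCoordinates_trivialization hq (A (f q)) (V q)).symm
  have h2 : mvfderiv 𝓘(ℝ, F) (fun q ↦ K (f q) (alongInChart f V p q)) p u =
      mvfderiv 𝓘(ℝ, E) K (f p) (mfderiv 𝓘(ℝ, F) 𝓘(ℝ, E) f p u) (alongInChart f V p p) +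
      K (f p) (mvfderiv 𝓘(ℝ, F) (alongInChart f V p) p u) := by
    refine (mvfderiv_clm_apply (a := K ∘ f) (hK.comp p hf) hV u).trans ?_
    have hKf : mvfderiv 𝓘(ℝ, F) (K ∘ f) p u =
        mvfderiv 𝓘(ℝ, E) K (f p) (mfderiv 𝓘(ℝ, F) 𝓘(ℝ, E) f p u) :=
      congrArg (fun L : F →L[ℝ] E →L[ℝ] E ↦ L u) (mfderiv_comp p hK hf)
    rw [hKf]
    rfl
  have hKp : K (f p) = A (f p) := inCoordinates_self (f p) (A (f p))
  have hVp : alongInChart f V p p = V p := trivializationAt_self_snd (f p) (V p)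
  rw [g.covDerivAlong_eq, g.covDerivAlong_eq]
  have h3 : mvfderiv 𝓘(ℝ, F) (alongInChart f (fun q ↦ A (f q) (V q)) p) p u = _ :=
    (congrArg (fun L : F →L[ℝ] E ↦ L u) h1.mfderiv_eq).trans h2
  rw [h3, hKp, hVp]
  -- Once everything is retyped in `E`, the two terms a(Γ v) cancel.
  let a : E →L[ℝ] E := A (f p)
  let Γ : E →L[ℝ] E := g.christoffel (f p) (mfderiv 𝓘(ℝ, F) 𝓘(ℝ, E) f p u)
  let d : E →L[ℝ] E := mvfderiv 𝓘(ℝ, E) K (f p) (mfderiv 𝓘(ℝ, F) 𝓘(ℝ, E) f p u)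
  let w : E := mvfderiv 𝓘(ℝ, F) (alongInChart f V p) p u
  let v : E := V p
  change (d v + a w) + Γ (a v) = (d v + Γ (a v) - a (Γ v)) + a (w + Γ v)
  rw [map_add]
  abel

end Submanifold

/-! ### Smoothness of vector fields along an immersion. -/

section Smoothness

variable {E : Type*} [NormedAddCommGroup E] [NormedSpace ℝ E]
  {M : Type*} [TopologicalSpace M] [ChartedSpace E M] [IsManifold 𝓘(ℝ, E) ∞ M]
  {F : Type*} [NormedAddCommGroup F] [NormedSpace ℝ F]
  {N : Type*} [TopologicalSpace N] [ChartedSpace F N] [IsManifold 𝓘(ℝ, F) ∞ N]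

lemma contMDiffAt_mfderiv_field {f : N → M} (hf : ContMDiff 𝓘(ℝ, F) 𝓘(ℝ, E) ∞ f) {p : N}
    {Y : ∀ q : N, TangentSpace 𝓘(ℝ, F) q}
    (hY : ContMDiffAt 𝓘(ℝ, F) 𝓘(ℝ, F).tangent ∞
      (fun x ↦ (⟨x, Y x⟩ : TangentBundle 𝓘(ℝ, F) N)) p) :
    ContMDiffAt 𝓘(ℝ, F) 𝓘(ℝ, E).tangent ∞
      (fun q ↦ (⟨f q, mfderiv 𝓘(ℝ, F) 𝓘(ℝ, E) f q (Y q)⟩ : TangentBundle 𝓘(ℝ, E) M)) p :=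
  (hf.contMDiff_tangentMap (m := ∞) (by norm_cast)).contMDiffAt.comp p hY

omit [IsManifold 𝓘(ℝ, F) ∞ N] in
lemma contMDiffAt_alongInChart {f : N → M} {p : N} {V : ∀ q : N, TangentSpace 𝓘(ℝ, E) (f q)}
    (hV : ContMDiffAt 𝓘(ℝ, F) 𝓘(ℝ, E).tangent ∞
      (fun q ↦ (⟨f q, V q⟩ : TangentBundle 𝓘(ℝ, E) M)) p) :
    ContMDiffAt 𝓘(ℝ, F) 𝓘(ℝ, E) ∞ (alongInChart f V p) p :=
  (contMDiffAt_totalSpace.1 hV).2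

lemma inTangentCoordinates_mfderiv_apply {f : N → M} {p q : N} (hq : q ∈ (chartAt F p).source)
    (hfq : f q ∈ (chartAt E (f p)).source) (u : TangentSpace 𝓘(ℝ, F) q) :
    inTangentCoordinates 𝓘(ℝ, F) 𝓘(ℝ, E) id f (mfderiv 𝓘(ℝ, F) 𝓘(ℝ, E) f) p q
      (trivializationAt F (TangentSpace 𝓘(ℝ, F)) p ⟨q, u⟩).2 =
      (trivializationAt E (TangentSpace 𝓘(ℝ, E)) (f p) ⟨f q, mfderiv 𝓘(ℝ, F) 𝓘(ℝ, E) f q u⟩).2 := by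
  have hq' : q ∈ (trivializationAt F (TangentSpace 𝓘(ℝ, F)) p).baseSet := by simpa using hq
  rw [trivializationAt_apply_snd hq, trivializationAt_apply_snd hfq]
  exact congrArg (fun u ↦ (trivializationAt E (TangentSpace 𝓘(ℝ, E)) (f p)).continuousLinearMapAt ℝ
      (f q) (mfderiv 𝓘(ℝ, F) 𝓘(ℝ, E) f q u))
    ((trivializationAt F (TangentSpace 𝓘(ℝ, F)) p).symmL_continuousLinearMapAt hq' u)

/-- A vector field whose image under an immersion is smooth is itself smooth. -/
lemma contMDiffAt_of_mfderiv_field [FiniteDimensional ℝ E] [FiniteDimensional ℝ F] {f : N → M}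
    (hf : ContMDiff 𝓘(ℝ, F) 𝓘(ℝ, E) ∞ f) {p : N}
    (hinj : Function.Injective (mfderiv 𝓘(ℝ, F) 𝓘(ℝ, E) f p))
    {Y : ∀ q : N, TangentSpace 𝓘(ℝ, F) q}
    (hY : ContMDiffAt 𝓘(ℝ, F) 𝓘(ℝ, E).tangent ∞
      (fun q ↦ (⟨f q, mfderiv 𝓘(ℝ, F) 𝓘(ℝ, E) f q (Y q)⟩ : TangentBundle 𝓘(ℝ, E) M)) p) :
    ContMDiffAt 𝓘(ℝ, F) 𝓘(ℝ, F).tangent ∞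
      (fun x ↦ (⟨x, Y x⟩ : TangentBundle 𝓘(ℝ, F) N)) p := by
  refine (contMDiffAt_section p).2 ?_
  let A : N → F →L[ℝ] E :=
    inTangentCoordinates 𝓘(ℝ, F) 𝓘(ℝ, E) id f (mfderiv 𝓘(ℝ, F) 𝓘(ℝ, E) f) p
  have hA : ContMDiffAt 𝓘(ℝ, F) 𝓘(ℝ, F →L[ℝ] E) ∞ A p :=
    (hf p).mfderiv_const (by norm_cast)
  have hAp (v : F) : A p v = mfderiv 𝓘(ℝ, F) 𝓘(ℝ, E) f p v := by
    have h := inTangentCoordinates_mfderiv_apply (mem_chart_source F p)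
      (mem_chart_source E (f p)) (v : TangentSpace 𝓘(ℝ, F) p)
    rw [trivializationAt_self_snd (f p)] at h
    exact (congrArg (A p) (trivializationAt_self_snd p (v : TangentSpace 𝓘(ℝ, F) p)).symm).trans h
  have hAinj : (A p).toLinearMap.ker = ⊥ :=
    LinearMap.ker_eq_bot.2 fun v w h ↦ hinj ((hAp v).symm.trans (h.trans (hAp w)))
  -- Fix a left inverse `L` of the differential at `p`. Near `p`, `L ∘L A q` stays invertible, so
  -- the coordinates of `Y` are recovered as (L A)⁻¹ L applied to those of its image, which is
  -- smooth.
  obtain ⟨L', hL'⟩ := (A p).toLinearMap.exists_leftInverse_of_injective hAinj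
  let L : E →L[ℝ] F := L'.toContinuousLinearMap
  have hL : L ∘L A p = ContinuousLinearMap.id ℝ F := by
    ext v
    exact LinearMap.congr_fun hL' v
  have hB : ContMDiffAt 𝓘(ℝ, F) 𝓘(ℝ, F →L[ℝ] F) ∞ (fun q ↦ L ∘L A q) p :=
    contMDiffAt_const.clm_comp hA
  have hinv : ContMDiffAt 𝓘(ℝ, F) 𝓘(ℝ, F →L[ℝ] F) ∞ (fun q ↦ (L ∘L A q).inverse) p := by
    have h : ContDiffAt ℝ ∞ ContinuousLinearMap.inverse (L ∘L A p) := by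
      rw [hL]
      exact contDiffAt_map_inverse (ContinuousLinearEquiv.refl ℝ F)
    exact h.contMDiffAt.comp p hB
  have hW := contMDiffAt_alongInChart hY
  have hLW : ContMDiffAt 𝓘(ℝ, F) 𝓘(ℝ, F) ∞
      (fun q ↦ L (alongInChart f (fun q ↦ mfderiv 𝓘(ℝ, F) 𝓘(ℝ, E) f q (Y q)) p q)) p :=
    contMDiffAt_const.clm_apply hW
  refine (hinv.clm_apply hLW).congr_of_eventuallyEq ?_
  have h1 : ∀ᶠ q in nhds p, (L ∘L A q).IsInvertible := by
    have h := (ContinuousLinearEquiv.refl ℝ F).nhds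
    have h2 : (L ∘L A p) = (ContinuousLinearEquiv.refl ℝ F : F →L[ℝ] F) := hL
    rw [← h2] at h
    exact hB.continuousAt.eventually h
  have h2 : ∀ᶠ q in nhds p, f q ∈ (chartAt E (f p)).source :=
    hf.continuous.continuousAt.eventually (chart_source_mem_nhds E (f p))
  filter_upwards [h1, h2, chart_source_mem_nhds F p] with q hq1 hq2 hq3
  rw [alongInChart, ← inTangentCoordinates_mfderiv_apply hq3 hq2]
  exact (hq1.inverse_apply_self _).symm

omit [IsManifold 𝓘(ℝ, F) ∞ N] in
lemma contMDiffAt_end_apply {f : N → M} (hf : ContMDiff 𝓘(ℝ, F) 𝓘(ℝ, E) ∞ f) {p : N}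
    {A : ∀ x : M, TangentSpace 𝓘(ℝ, E) x →L[ℝ] TangentSpace 𝓘(ℝ, E) x}
    {U : Set M} (hU : IsOpen U) (hA : IsSmoothEndOn A U) (hp : f p ∈ U)
    {V : ∀ q : N, TangentSpace 𝓘(ℝ, E) (f q)}
    (hV : ContMDiffAt 𝓘(ℝ, F) 𝓘(ℝ, E).tangent ∞
      (fun q ↦ (⟨f q, V q⟩ : TangentBundle 𝓘(ℝ, E) M)) p) :
    ContMDiffAt 𝓘(ℝ, F) 𝓘(ℝ, E).tangent ∞
      (fun q ↦ (⟨f q, A (f q) (V q)⟩ : TangentBundle 𝓘(ℝ, E) M)) p := by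
  have h1 := (hA.contMDiffAt (hU.mem_nhds hp)).comp p (hf p)
  exact ContMDiffAt.clm_bundle_apply h1 hV

end Smoothness

/-! ### Normal parts, and the action of the J_a on sections of D. -/

section CRSubmanifold

variable {E : Type*} [NormedAddCommGroup E] [NormedSpace ℝ E]
  {M : Type*} [TopologicalSpace M] [ChartedSpace E M] [IsManifold 𝓘(ℝ, E) ∞ M]
  {F : Type*} [NormedAddCommGroup F] [NormedSpace ℝ F]
  {N : Type*} [TopologicalSpace N] [ChartedSpace F N]

lemma SemiRiemannianMetric.covDerivAlong_congr
    (g : SemiRiemannianMetric E M) {f : N → M}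
    {V W : ∀ q : N, TangentSpace 𝓘(ℝ, E) (f q)} {p : N} (h : ∀ᶠ q in nhds p, V q = W q)
    (u : TangentSpace 𝓘(ℝ, F) p) : g.covDerivAlong f V p u = g.covDerivAlong f W p u := by
  have h1 : alongInChart f V p =ᶠ[nhds p] alongInChart f W p :=
    h.mono fun q hq ↦ by rw [alongInChart, alongInChart, hq]
  have h2 : mvfderiv 𝓘(ℝ, F) (alongInChart f V p) p u =
      mvfderiv 𝓘(ℝ, F) (alongInChart f W p) p u :=
    congrArg (fun L : F →L[ℝ] E ↦ L u) h1.mfderiv_eq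
  rw [g.covDerivAlong_eq, g.covDerivAlong_eq, h2, h.self_of_nhds]

lemma SemiRiemannianMetric.covDerivAlong_smul (g : SemiRiemannianMetric E M) (f : N → M)
    (V : ∀ q : N, TangentSpace 𝓘(ℝ, E) (f q)) (p : N) (c : ℝ) (u : TangentSpace 𝓘(ℝ, F) p) :
    g.covDerivAlong f V p (c • u) = c • g.covDerivAlong f V p u := by
  -- `christoffel` is bundled as linear only in its second argument; symmetry moves `u` there.
  have h (u : TangentSpace 𝓘(ℝ, F) p) : g.covDerivAlong f V p u = HAdd.hAdd (α := E) (β := E)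
      (mvfderiv 𝓘(ℝ, F) (alongInChart f V p) p u)
      ((g.christoffel (f p) (V p)) (mfderiv 𝓘(ℝ, F) 𝓘(ℝ, E) f p u)) := by
    rw [g.covDerivAlong_eq, g.christoffel_symm]
  rw [h, h]
  simp only [map_smul]
  exact (smul_add (A := E) c _ _).symm

lemma mfderiv_injective {g : SemiRiemannianMetric E M} {f : N → M}
    (hf : IsNondegenerateSubmanifold F g f) (p : N) :
    Function.Injective (mfderiv 𝓘(ℝ, F) 𝓘(ℝ, E) f p) := by
  refine (injective_iff_map_eq_zero _).2 fun u hu ↦ hf.nondegenerate p u fun v ↦ ?_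
  change g.val (f p) (mfderiv 𝓘(ℝ, F) 𝓘(ℝ, E) f p u) (mfderiv 𝓘(ℝ, F) 𝓘(ℝ, E) f p v) = 0
  rw [hu, map_zero]
  rfl

/-- The induced form is injective into a dual of equal finite dimension, hence invertible, so
`inverse` is a true inverse and not its default 0. -/
lemma SemiRiemannianMetric.tangentPart_mfderiv [FiniteDimensional ℝ F]
    {g : SemiRiemannianMetric E M} {f : N → M}
    (hf : IsNondegenerateSubmanifold F g f) (p : N) (u : TangentSpace 𝓘(ℝ, F) p) :
    g.tangentPart f p (mfderiv 𝓘(ℝ, F) 𝓘(ℝ, E) f p u) = u := by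
  let L : F →L[ℝ] F →L[ℝ] ℝ := g.induced f p
  have hinj : Function.Injective L := by
    refine (injective_iff_map_eq_zero _).2 fun u hu ↦ hf.nondegenerate p u fun v ↦ ?_
    exact congrArg (fun l : F →L[ℝ] ℝ ↦ l v) hu
  have hrank : Module.finrank ℝ F = Module.finrank ℝ (F →L[ℝ] ℝ) := by
    rw [← (LinearMap.toContinuousLinearMap (𝕜 := ℝ) (E := F) (F' := ℝ)).finrank_eq]
    exact (Subspace.dual_finrank_eq (K := ℝ) (V := F)).symm
  let e : F ≃L[ℝ] (F →L[ℝ] ℝ) :=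
    (LinearEquiv.ofInjectiveOfFinrankEq L.toLinearMap hinj hrank).toContinuousLinearEquiv
  have hL : L.IsInvertible := ⟨e, by ext; rfl⟩
  exact hL.inverse_apply_self u

lemma SemiRiemannianMetric.normalPart_mfderiv [FiniteDimensional ℝ F]
    {g : SemiRiemannianMetric E M} {f : N → M}
    (hf : IsNondegenerateSubmanifold F g f) (p : N) (u : TangentSpace 𝓘(ℝ, F) p) :
    g.normalPart F f p (mfderiv 𝓘(ℝ, F) 𝓘(ℝ, E) f p u) = 0 := by
  rw [normalPart, tangentPart_mfderiv hf, sub_self]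

lemma SemiRiemannianMetric.normalPart_add (g : SemiRiemannianMetric E M) (f : N → M) (p : N)
    (v w : TangentSpace 𝓘(ℝ, E) (f p)) :
    g.normalPart F f p (v + w) = g.normalPart F f p v + g.normalPart F f p w := by
  simp only [normalPart, tangentPart, map_add, ContinuousLinearMap.add_comp]
  abel

lemma SemiRiemannianMetric.normalPart_smul (g : SemiRiemannianMetric E M) (f : N → M) (p : N)
    (c : ℝ) (v : TangentSpace 𝓘(ℝ, E) (f p)) :
    g.normalPart F f p (c • v) = c • g.normalPart F f p v := by
  simp only [normalPart, tangentPart, map_smul, ContinuousLinearMap.smul_comp, smul_sub]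

/-- A subspace contains every vector orthogonal to its orthogonal complement. -/
lemma mem_of_orthogonal_orthogonal {G : Type*} [NormedAddCommGroup G] [NormedSpace ℝ G]
    [FiniteDimensional ℝ G] (b : G →L[ℝ] G →L[ℝ] ℝ) (hs : ∀ u v, b u v = b v u)
    (hb : ∀ u, (∀ v, b u v = 0) → u = 0) (W : Submodule ℝ G) (u : G)
    (hu : ∀ z, (∀ v ∈ W, b z v = 0) → b u z = 0) : u ∈ W := by
  let B : LinearMap.BilinForm ℝ G := b.toLinearMap₁₂
  have hrefl : B.IsRefl := fun v w h ↦ (hs w v).trans h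
  have hnd : B.Nondegenerate :=
    ⟨fun v h ↦ hb v h, fun v h ↦ hb v fun w ↦ (hs v w).trans (h w)⟩
  -- The double orthogonal returns `W` because `b` is non-degenerate on all of `G`.
  rw [← LinearMap.BilinForm.orthogonal_orthogonal hnd hrefl W]
  refine LinearMap.BilinForm.mem_orthogonal_iff.2 fun z hz ↦ ?_
  have hz' := LinearMap.BilinForm.mem_orthogonal_iff.1 hz
  exact (hs z u).trans (hu z fun v hv ↦ (hs z v).trans (hz' v hv))

variable [IsManifold 𝓘(ℝ, F) ∞ N]

lemma IsSmoothFieldOn.contMDiffAt {U : Set N} {X : ∀ q : N, TangentSpace 𝓘(ℝ, F) q}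
    (hX : IsSmoothFieldOn X U) (hU : IsOpen U) {q : N} (hq : q ∈ U) :
    ContMDiffAt 𝓘(ℝ, F) 𝓘(ℝ, F).tangent ∞
      (fun x ↦ (⟨x, X x⟩ : TangentBundle 𝓘(ℝ, F) N)) q :=
  ContMDiffOn.contMDiffAt hX (hU.mem_nhds hq)

lemma IsSectionOn.mono {D : ∀ x : N, Submodule ℝ (TangentSpace 𝓘(ℝ, F) x)} {U U' : Set N}
    {X : ∀ q : N, TangentSpace 𝓘(ℝ, F) q} (hX : IsSectionOn D X U) (h : U' ⊆ U) :
    IsSectionOn D X U' :=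
  ⟨ContMDiffOn.mono hX.1 h, fun q hq ↦ hX.2 q (h hq)⟩

variable [FiniteDimensional ℝ E] [FiniteDimensional ℝ F]
  {g : SemiRiemannianMetric E M} {σ : AlmostParaquaternionicStructure E M} {f : N → M}
  {D : ∀ x : N, Submodule ℝ (TangentSpace 𝓘(ℝ, F) x)} {V : Set M}
  {J : Fin 3 → ∀ x : M, TangentSpace 𝓘(ℝ, E) x →L[ℝ] TangentSpace 𝓘(ℝ, E) x}
  {U : Set N} {X Y : ∀ q : N, TangentSpace 𝓘(ℝ, F) q}

omit [FiniteDimensional ℝ E] [FiniteDimensional ℝ F] in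
lemma IsParaquaternionicCRSubmanifold.contMDiff (hN : IsParaquaternionicCRSubmanifold g σ f D) :
    ContMDiff 𝓘(ℝ, F) 𝓘(ℝ, E) ∞ f :=
  hN.submanifold.isImmersion.contMDiff

omit [FiniteDimensional ℝ E] [FiniteDimensional ℝ F] in
lemma IsParaquaternionicCRSubmanifold.exists_mfderiv_eq
    (hN : IsParaquaternionicCRSubmanifold g σ f D)
    (hJ : IsCanonicalLocalBasis σ.fiber V J) {q : N} (hq : f q ∈ V) (a : Fin 3)
    {u : TangentSpace 𝓘(ℝ, F) q} (hu : u ∈ D q) :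
    ∃ w ∈ D q, mfderiv 𝓘(ℝ, F) 𝓘(ℝ, E) f q w = J a (f q) (mfderiv 𝓘(ℝ, F) 𝓘(ℝ, E) f q u) := by
  have h := Submodule.mem_map_of_mem (f := (J a (f q)).toLinearMap)
    (Submodule.mem_map_of_mem (f := (mfderiv 𝓘(ℝ, F) 𝓘(ℝ, E) f q).toLinearMap) hu)
  rw [hN.invariant V J hJ q hq a] at h
  exact h

/-- The structure `J_a` of the ambient manifold acts on the sections of `D`. -/
lemma IsParaquaternionicCRSubmanifold.exists_section
    (hN : IsParaquaternionicCRSubmanifold g σ f D)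
    (hJ : IsCanonicalLocalBasis σ.fiber V J) (hU : IsOpen U) (hUV : ∀ q ∈ U, f q ∈ V)
    (hX : IsSectionOn D X U) (a : Fin 3) :
    ∃ X', IsSectionOn D X' U ∧ ∀ q ∈ U, mfderiv 𝓘(ℝ, F) 𝓘(ℝ, E) f q (X' q) =
      J a (f q) (mfderiv 𝓘(ℝ, F) 𝓘(ℝ, E) f q (X q)) := by
  -- The field is chosen pointwise, with value 0 off `U`; smoothness follows because its image under
  -- the immersion is smooth.
  have h (q : N) : ∃ w, q ∈ U → w ∈ D q ∧ mfderiv 𝓘(ℝ, F) 𝓘(ℝ, E) f q w =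
      J a (f q) (mfderiv 𝓘(ℝ, F) 𝓘(ℝ, E) f q (X q)) := by
    by_cases hq : q ∈ U
    · obtain ⟨w, hw⟩ := hN.exists_mfderiv_eq hJ (hUV q hq) a (hX.2 q hq)
      exact ⟨w, fun _ ↦ hw⟩
    · exact ⟨0, fun h ↦ absurd h hq⟩
  choose X' hX' using h
  refine ⟨X', ⟨fun q hq ↦ ?_, fun q hq ↦ (hX' q hq).1⟩, fun q hq ↦ (hX' q hq).2⟩
  refine (contMDiffAt_of_mfderiv_field hN.contMDiff
    (mfderiv_injective hN.submanifold q) ?_).contMDiffWithinAt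
  refine (contMDiffAt_end_apply hN.contMDiff hJ.isOpen (hJ.smooth a) (hUV q hq)
    (contMDiffAt_mfderiv_field hN.contMDiff (hX.1.contMDiffAt hU hq))).congr_of_eventuallyEq ?_
  filter_upwards [hU.mem_nhds hq] with r hr
  rw [(hX' r hr).2]

omit [FiniteDimensional ℝ E] [FiniteDimensional ℝ F] in
/-- `∇ (J_a Y) - J_a ∇ Y` is tangent to `D`, for a section `Y` of `D`. -/
lemma IsParaquaternionicCRSubmanifold.exists_covDerivAlong_eq
    (hM : IsParaquaternionicKahler g σ) (hN : IsParaquaternionicCRSubmanifold g σ f D)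
    (hJ : IsCanonicalLocalBasis σ.fiber V J) (hU : IsOpen U) (hUV : ∀ q ∈ U, f q ∈ V)
    (hX : IsSectionOn D X U) (a : Fin 3) {X' : ∀ q : N, TangentSpace 𝓘(ℝ, F) q}
    (hX' : ∀ q ∈ U, mfderiv 𝓘(ℝ, F) 𝓘(ℝ, E) f q (X' q) =
      J a (f q) (mfderiv 𝓘(ℝ, F) 𝓘(ℝ, E) f q (X q))) {p : N} (hp : p ∈ U)
    (u : TangentSpace 𝓘(ℝ, F) p) :
    ∃ d ∈ D p, g.covDerivAlong f (fun q ↦ mfderiv 𝓘(ℝ, F) 𝓘(ℝ, E) f q (X' q)) p u =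
      mfderiv 𝓘(ℝ, F) 𝓘(ℝ, E) f p d +
        J a (f p) (g.covDerivAlong f (fun q ↦ mfderiv 𝓘(ℝ, F) 𝓘(ℝ, E) f q (X q)) p u) := by
  have hfd : MDifferentiableAt 𝓘(ℝ, F) 𝓘(ℝ, E) f p := (hN.contMDiff p).mdifferentiableAt (by simp)
  have hXd := (contMDiffAt_alongInChart (contMDiffAt_mfderiv_field hN.contMDiff
    (hX.1.contMDiffAt hU hp))).mdifferentiableAt (by simp)
  have hmem : g.covDerivEnd (J a) (f p) (mfderiv 𝓘(ℝ, F) 𝓘(ℝ, E) f p u) ∈ σ.fiber (f p) := by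
    refine hM.parallel V (J a) hJ.isOpen (hJ.smooth a) (fun x hx ↦ ?_) (f p) (hUV p hp) _
    rw [← hJ.span_eq x hx]
    exact Submodule.subset_span ⟨a, rfl⟩
  -- Every element of σ is a combination of the J_b, each of which preserves D.
  have hspan : ∀ A ∈ σ.fiber (f p), ∃ d ∈ D p, mfderiv 𝓘(ℝ, F) 𝓘(ℝ, E) f p d =
      A (mfderiv 𝓘(ℝ, F) 𝓘(ℝ, E) f p (X p)) := by
    intro A hA
    rw [← hJ.span_eq (f p) (hUV p hp)] at hA
    induction hA using Submodule.span_induction with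
    | mem A hA =>
      obtain ⟨b, rfl⟩ := hA
      exact hN.exists_mfderiv_eq hJ (hUV p hp) b (hX.2 p hp)
    | zero => exact ⟨0, (D p).zero_mem, by rw [map_zero]; rfl⟩
    | add A B _ _ hA hB =>
      obtain ⟨d, hd, hdA⟩ := hA
      obtain ⟨e, he, heB⟩ := hB
      exact ⟨d + e, (D p).add_mem hd he, by rw [map_add, hdA, heB]; rfl⟩
    | smul c A _ hA =>
      obtain ⟨d, hd, hdA⟩ := hA
      exact ⟨c • d, (D p).smul_mem c hd, by rw [map_smul, hdA]; rfl⟩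
  obtain ⟨d, hd, hdA⟩ := hspan _ hmem
  refine ⟨d, hd, ?_⟩
  rw [hdA, ← g.covDerivAlong_end_apply hfd hJ.isOpen (hJ.smooth a) (hUV p hp) hXd u]
  refine g.covDerivAlong_congr ?_ u
  filter_upwards [hU.mem_nhds hp] with r hr using hX' r hr

end CRSubmanifold

/-! ### The two implications. -/

section Main

variable {E : Type*} [NormedAddCommGroup E] [NormedSpace ℝ E] [FiniteDimensional ℝ E]
  {M : Type*} [TopologicalSpace M] [ChartedSpace E M] [IsManifold 𝓘(ℝ, E) ∞ M]
  {F : Type*} [NormedAddCommGroup F] [NormedSpace ℝ F] [FiniteDimensional ℝ F]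
  {N : Type*} [TopologicalSpace N] [ChartedSpace F N] [IsManifold 𝓘(ℝ, F) ∞ N]
  {g : SemiRiemannianMetric E M} {σ : AlmostParaquaternionicStructure E M} {f : N → M}
  {D : ∀ x : N, Submodule ℝ (TangentSpace 𝓘(ℝ, F) x)}

omit [FiniteDimensional ℝ E] in
lemma IsParaquaternionicCRSubmanifold.covDerivAlong_sub
    (hN : IsParaquaternionicCRSubmanifold g σ f D) {U : Set N}
    {X Y : ∀ q : N, TangentSpace 𝓘(ℝ, F) q} (hU : IsOpen U) (hX : IsSectionOn D X U)
    (hY : IsSectionOn D Y U) {p : N} (hp : p ∈ U) :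
    g.covDerivAlong f (fun q ↦ mfderiv 𝓘(ℝ, F) 𝓘(ℝ, E) f q (Y q)) p (X p) -
      g.covDerivAlong f (fun q ↦ mfderiv 𝓘(ℝ, F) 𝓘(ℝ, E) f q (X q)) p (Y p) =
      mfderiv 𝓘(ℝ, F) 𝓘(ℝ, E) f p (VectorField.mlieBracket 𝓘(ℝ, F) X Y p) :=
  have := FiniteDimensional.complete ℝ F
  g.covDerivAlong_sub_covDerivAlong hN.contMDiff
    ((hX.1.contMDiffAt hU hp).mdifferentiableAt (by simp))
    ((hY.1.contMDiffAt hU hp).mdifferentiableAt (by simp))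

omit [FiniteDimensional ℝ E] in
lemma IsParaquaternionicCRSubmanifold.secondFundamentalForm_comm
    (hN : IsParaquaternionicCRSubmanifold g σ f D) {U : Set N}
    {X Y : ∀ q : N, TangentSpace 𝓘(ℝ, F) q} (hU : IsOpen U) (hX : IsSectionOn D X U)
    (hY : IsSectionOn D Y U) {p : N} (hp : p ∈ U) :
    g.secondFundamentalForm f X Y p = g.secondFundamentalForm f Y X p := by
  have h := hN.covDerivAlong_sub hU hX hY hp
  rw [sub_eq_iff_eq_add] at h
  unfold SemiRiemannianMetric.secondFundamentalForm
  rw [h, g.normalPart_add, SemiRiemannianMetric.normalPart_mfderiv hN.submanifold, zero_add]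

-- B depends on its first field only through the value at `p`, so identities among the J_a are
-- needed only at `p`; symmetry of B carries this over to the second slot.
omit [FiniteDimensional ℝ E] [FiniteDimensional ℝ F] [IsManifold 𝓘(ℝ, F) ∞ N] in
lemma SemiRiemannianMetric.secondFundamentalForm_of_eq_smul
    {X X' Y : ∀ q : N, TangentSpace 𝓘(ℝ, F) q} {p : N} {c : ℝ} (h : X' p = c • X p) :
    g.secondFundamentalForm f X' Y p = c • g.secondFundamentalForm f X Y p := by
  unfold SemiRiemannianMetric.secondFundamentalForm
  rw [h, g.covDerivAlong_smul, g.normalPart_smul]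

omit [FiniteDimensional ℝ E] in
/-- If `D` is integrable, then `B(X, J_a Y) = B(J_a X, Y)`. -/
lemma IsParaquaternionicCRSubmanifold.secondFundamentalForm_swap
    (hM : IsParaquaternionicKahler g σ) (hN : IsParaquaternionicCRSubmanifold g σ f D)
    (hD : IsIntegrable D) {V : Set M}
    {J : Fin 3 → ∀ x : M, TangentSpace 𝓘(ℝ, E) x →L[ℝ] TangentSpace 𝓘(ℝ, E) x}
    (hJ : IsCanonicalLocalBasis σ.fiber V J) {U : Set N} (hU : IsOpen U) (hUV : ∀ q ∈ U, f q ∈ V)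
    {X Y X' Y' : ∀ q : N, TangentSpace 𝓘(ℝ, F) q} (hX : IsSectionOn D X U)
    (hY : IsSectionOn D Y U) (hX' : IsSectionOn D X' U) (a : Fin 3)
    (hXX' : ∀ q ∈ U, mfderiv 𝓘(ℝ, F) 𝓘(ℝ, E) f q (X' q) =
      J a (f q) (mfderiv 𝓘(ℝ, F) 𝓘(ℝ, E) f q (X q)))
    (hYY' : ∀ q ∈ U, mfderiv 𝓘(ℝ, F) 𝓘(ℝ, E) f q (Y' q) =
      J a (f q) (mfderiv 𝓘(ℝ, F) 𝓘(ℝ, E) f q (Y q))) {p : N} (hp : p ∈ U) :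
    g.secondFundamentalForm f X Y' p = g.secondFundamentalForm f X' Y p := by
  rw [hN.secondFundamentalForm_comm hU hX' hY hp]
  obtain ⟨d, -, hdX⟩ := hN.exists_covDerivAlong_eq hM hJ hU hUV hX a hXX' hp (Y p)
  obtain ⟨e, -, heY⟩ := hN.exists_covDerivAlong_eq hM hJ hU hUV hY a hYY' hp (X p)
  -- Integrability is used here: it makes J_a[X, Y] tangent to `N`.
  obtain ⟨w, -, hw⟩ := hN.exists_mfderiv_eq hJ (hUV p hp) a (hD U X Y hU hX hY p hp)
  have h := hN.covDerivAlong_sub hU hX hY hp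
  rw [sub_eq_iff_eq_add] at h
  unfold SemiRiemannianMetric.secondFundamentalForm
  rw [hdX, heY, h, map_add, ← hw]
  simp only [g.normalPart_add, SemiRiemannianMetric.normalPart_mfderiv hN.submanifold, zero_add]

lemma IsParaquaternionicCRSubmanifold.isGeodesicFor
    (hM : IsParaquaternionicKahler g σ) (hN : IsParaquaternionicCRSubmanifold g σ f D)
    (hD : IsIntegrable D) : IsGeodesicFor g f D := by
  intro U₀ X Y hU₀ hX hY p hp₀
  obtain ⟨V, hpV, J, hJ⟩ := σ.exists_basis (f p)
  set U : Set N := U₀ ∩ f ⁻¹' V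
  have hU : IsOpen U := hU₀.inter (hJ.isOpen.preimage hN.contMDiff.continuous)
  have hUV : ∀ q ∈ U, f q ∈ V := fun q hq ↦ hq.2
  have hp : p ∈ U := ⟨hp₀, hpV⟩
  replace hX := hX.mono (Set.inter_subset_left : U ⊆ U₀)
  replace hY := hY.mono (Set.inter_subset_left : U ⊆ U₀)
  have hinj := mfderiv_injective hN.submanifold p
  -- B(J₂X, Y) = 0: J₂ crosses B with sign +1 directly (`s3`), but with sign -1 when written through
  -- J₀ and J₁ (`s1`, `s2`).
  have key (X Y X₂ : ∀ q : N, TangentSpace 𝓘(ℝ, F) q) (hX : IsSectionOn D X U)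
      (hY : IsSectionOn D Y U) (hX₂ : IsSectionOn D X₂ U)
      (h2 : ∀ q ∈ U, mfderiv 𝓘(ℝ, F) 𝓘(ℝ, E) f q (X₂ q) =
      J 2 (f q) (mfderiv 𝓘(ℝ, F) 𝓘(ℝ, E) f q (X q))) :
      g.secondFundamentalForm f X₂ Y p = 0 := by
    obtain ⟨X₀, hX₀, h0⟩ := hN.exists_section hJ hU hUV hX 0
    obtain ⟨X₁₀, hX₁₀, h10⟩ := hN.exists_section hJ hU hUV hX₀ 1
    obtain ⟨Y₁, hY₁, k1⟩ := hN.exists_section hJ hU hUV hY 1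
    obtain ⟨Y₀₁, hY₀₁, k01⟩ := hN.exists_section hJ hU hUV hY₁ 0
    obtain ⟨Y₂, hY₂, k2⟩ := hN.exists_section hJ hU hUV hY 2
    have hm : J 0 (f p) ∘L J 1 (f p) = (-1 : ℝ) • J 2 (f p) := by
      have := hJ.mul (f p) hpV 0
      simpa [epsilon] using this
    have hm' : J 1 (f p) ∘L J 0 (f p) = J 2 (f p) := by
      have := hJ.anticomm (f p) hpV 0
      rw [zero_add, hm] at this
      simpa using this.symm
    have e1 : X₁₀ p = X₂ p := hinj <| by
      rw [h10 p hp, h0 p hp, h2 p hp, ← hm']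
      rfl
    have e2 : Y₀₁ p = (-1 : ℝ) • Y₂ p := hinj <| by
      rw [k01 p hp, k1 p hp, map_smul, k2 p hp]
      exact congrArg (fun L ↦ L (mfderiv 𝓘(ℝ, F) 𝓘(ℝ, E) f p (Y p))) hm
    have s1 := hN.secondFundamentalForm_swap hM hD hJ hU hUV hX hY₁ hX₀ 0 h0 k01 hp
    have s2 := hN.secondFundamentalForm_swap hM hD hJ hU hUV hX₀ hY hX₁₀ 1 h10 k1 hp
    have s3 := hN.secondFundamentalForm_swap hM hD hJ hU hUV hX hY hX₂ 2 h2 k2 hp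
    have e3 : g.secondFundamentalForm f X₁₀ Y p = g.secondFundamentalForm f X₂ Y p := by
      rw [SemiRiemannianMetric.secondFundamentalForm_of_eq_smul (c := 1)
        (e1.trans (one_smul ℝ _).symm), one_smul]
    have e4 : g.secondFundamentalForm f X Y₀₁ p = (-1 : ℝ) • g.secondFundamentalForm f X Y₂ p := by
      rw [hN.secondFundamentalForm_comm hU hX hY₀₁ hp,
        SemiRiemannianMetric.secondFundamentalForm_of_eq_smul e2,
        hN.secondFundamentalForm_comm hU hX hY₂ hp]
    have e5 : g.secondFundamentalForm f X₂ Y p =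
        (-1 : ℝ) • g.secondFundamentalForm f X₂ Y p := by
      rw [← s3, ← e4, s1, s2, e3, s3]
    have e6 : (2 : ℝ) • g.secondFundamentalForm f X₂ Y p = 0 := by
      rw [two_smul]
      nth_rw 1 [e5]
      rw [neg_one_smul, neg_add_cancel]
    exact (smul_eq_zero.1 e6).resolve_left (by norm_num)
  -- J₂² = Id, so X = J₂(J₂X) at `p` and `key` applies to J₂X.
  obtain ⟨X₂, hX₂, h2⟩ := hN.exists_section hJ hU hUV hX 2
  obtain ⟨X₂₂, hX₂₂, h22⟩ := hN.exists_section hJ hU hUV hX₂ 2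
  have e : X₂₂ p = X p := hinj <| by
    rw [h22 p hp, h2 p hp]
    have h := hJ.sq (f p) hpV 2
    simp only [epsilon, Matrix.cons_val, neg_neg, one_smul] at h
    exact congrArg (fun L ↦ L (mfderiv 𝓘(ℝ, F) 𝓘(ℝ, E) f p (X p))) h
  have h := key X₂ Y X₂₂ hX₂ hY hX₂₂ h22
  rwa [SemiRiemannianMetric.secondFundamentalForm_of_eq_smul (c := 1)
    (e.trans (one_smul ℝ _).symm), one_smul] at h

lemma IsParaquaternionicCRSubmanifold.isIntegrable
    (hM : IsParaquaternionicKahler g σ) (hN : IsParaquaternionicCRSubmanifold g σ f D)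
    (hD : IsGeodesicFor g f D) : IsIntegrable D := by
  intro U₀ X Y hU₀ hX hY p hp₀
  obtain ⟨V, hpV, J, hJ⟩ := σ.exists_basis (f p)
  set U : Set N := U₀ ∩ f ⁻¹' V
  have hU : IsOpen U := hU₀.inter (hJ.isOpen.preimage hN.contMDiff.continuous)
  have hUV : ∀ q ∈ U, f q ∈ V := fun q hq ↦ hq.2
  have hp : p ∈ U := ⟨hp₀, hpV⟩
  replace hX := hX.mono (Set.inter_subset_left : U ⊆ U₀)
  replace hY := hY.mono (Set.inter_subset_left : U ⊆ U₀)
  -- It suffices to test the bracket against each `z` orthogonal to D.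
  refine mem_of_orthogonal_orthogonal (G := F) (g.induced f p) (fun u v ↦ g.symm (f p) _ _)
    (hN.submanifold.nondegenerate p) (D p) _ fun z hz ↦ ?_
  have key (X Y : ∀ q : N, TangentSpace 𝓘(ℝ, F) q) (hX : IsSectionOn D X U)
      (hY : IsSectionOn D Y U) : g.val (f p)
      (g.covDerivAlong f (fun q ↦ mfderiv 𝓘(ℝ, F) 𝓘(ℝ, E) f q (Y q)) p (X p))
      (mfderiv 𝓘(ℝ, F) 𝓘(ℝ, E) f p z) = 0 := by
    obtain ⟨Y', hY', k⟩ := hN.exists_section hJ hU hUV hY 0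
    obtain ⟨d, -, hd⟩ := hN.exists_covDerivAlong_eq hM hJ hU hUV hY 0 k hp (X p)
    have hB : g.normalPart F f p _ = 0 := hD U X Y' hU hX hY' p hp
    -- Since B(X, J₀Y) = 0, the vector J₀∇_X Y is the image of a tangent vector of `N`.
    rw [SemiRiemannianMetric.normalPart, sub_eq_zero, hd] at hB
    replace hB := eq_sub_of_add_eq' hB
    rw [← map_sub] at hB
    have hA := hM.adapted V J hJ (f p) hpV 0
      (g.covDerivAlong f (fun q ↦ mfderiv 𝓘(ℝ, F) 𝓘(ℝ, E) f q (Y q)) p (X p))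
      (mfderiv 𝓘(ℝ, F) 𝓘(ℝ, E) f p z)
    have ht := hN.totallyReal V J hJ p hpV 0 z hz
    -- J₀z is normal, so the left side vanishes; the factor ε is 1 for J₀.
    rw [g.symm, hB, g.symm, g.symm, ht] at hA
    simpa [epsilon] using hA.symm
  change g.val (f p) (mfderiv 𝓘(ℝ, F) 𝓘(ℝ, E) f p _) (mfderiv 𝓘(ℝ, F) 𝓘(ℝ, E) f p z) = 0
  rw [← hN.covDerivAlong_sub hU hX hY hp, map_sub, sub_apply,
    key X Y hX hY, key Y X hY hX, sub_zero]

end Main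

end ParaquaternionicGeometry

end

theorem mainTheorem2
    {E : Type*} [NormedAddCommGroup E] [NormedSpace ℝ E] [FiniteDimensional ℝ E]
    {M : Type*} [TopologicalSpace M] [ChartedSpace E M] [IsManifold 𝓘(ℝ, E) ∞ M]
    {F : Type*} [NormedAddCommGroup F] [NormedSpace ℝ F] [FiniteDimensional ℝ F]
    {N : Type*} [TopologicalSpace N] [ChartedSpace F N] [IsManifold 𝓘(ℝ, F) ∞ N]
    (g : ParaquaternionicGeometry.SemiRiemannianMetric E M)
    (σ : ParaquaternionicGeometry.AlmostParaquaternionicStructure E M)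
    (hM : ParaquaternionicGeometry.IsParaquaternionicKahler g σ)
    (f : N → M) (D : ∀ x : N, Submodule ℝ (TangentSpace 𝓘(ℝ, F) x))
    (hN : ParaquaternionicGeometry.IsParaquaternionicCRSubmanifold g σ f D) :
    ParaquaternionicGeometry.IsIntegrable D ↔
      ParaquaternionicGeometry.IsGeodesicFor g f D :=
  ⟨fun h ↦ hN.isGeodesicFor hM h, fun h ↦ hN.isIntegrable hM h⟩
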